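/- \textbf{Theorem (SGD with adaptive learning rates).} Let $\mathbb{N}=\{1,2,3,\dots\}$, $\mathbb{N}_0=\mathbb{N}\cup\{0\}$, let $d\in\mathbb{N}$, $\vartheta\in(0,\infty)$, let $\|\cdot\|$ be the Euclidean norm on $\mathbb{R}^d$, let $(\Omega,\mathcal{F},\mathbb{P})$ be a probability space, and let $X_{n,m}\colon\Omega\to\mathbb{R}^d$, $(n,m)\in\mathbb{Z}^2$, be i.i.d. random variables which are non-degenerate in the sense that the topological support of their common distribution has non-empty interior. Let $\ell\colon\mathbb{R}^d\times\mathbb{R}^d\to\mathbb{R}$ be given by $\ell(\theta,x)=\vartheta\|\theta-x\|^2$, let $M,\mathfrak{M}\in\mathbb{N}$, and let $\Theta\colon\mathbb{N}_0\times\Omega\to\mathbb{R}^d$ and $\gamma\colon\mathbb{N}\times\Omega\to\mathbb{R}$ be stochastic processes which satisfy for all $n\in\mathbb{N}$ that $$\Theta_n=\Theta_{n-1}-\frac{\gamma_n}{M}\Bigl[\sum_{m=1}^{M}(\nabla_\theta\ell)(\Theta_{n-1},X_{n,m})\Bigr].$$ Let $(\nu_n)_{n\in\mathbb{N}}\subseteq\mathbb{R}$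 be strictly decreasing with $\lim_{n\to\infty}\nu_n=0$ and $\sum_{n=1}^{\infty}\nu_n=\infty$. Assume that $\gamma_1=\nu_1<\vartheta^{-1}$ and that for all $n\in\mathbb{N}$ $$\gamma_{n+1}=\begin{cases}\gamma_n & \colon\ \sum_{m=1}^{\mathfrak{M}}\ell(\Theta_n,X_{n,-m})\le\sum_{m=1}^{\mathfrak{M}}\ell(\Theta_{n-1},X_{n,-m}),\\[1ex] \max\bigl((0,\gamma_n)\cap\{\nu_k\colon k\in\mathbb{N}\}\bigr) & \colon\ \sum_{m=1}^{\mathfrak{M}}\ell(\Theta_n,X_{n,-m})>\sum_{m=1}^{\mathfrak{M}}\ell(\Theta_{n-1},X_{n,-m}).\end{cases}$$ For every $t\in[0,\infty)$ let $N_t=\inf\{n\in\mathbb{N}_0\colon\sum_{k=1}^{n}\gamma_k\ge t\}$. Assume that $(X_{n,m})_{(n,m)\in\mathbb{Z}^2}$ and $\Theta_0$ are independent and that $$\mathbb{E}\Bigl[\|\Theta_0\|^2+\sup_{n\in\mathbb{N}}\|X_{n,0}\|\Bigr]<\infty.$$ Then $X_{1,1}$ is integrable, $\mathbb{E}\bigl[\|\Theta_{N_t}-\mathbb{E}[X_{1,1}]\|^2\bigr]<\infty$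 for every $t\in[0,\infty)$, and $$\lim_{t\to\infty}\mathbb{E}\bigl[\|\Theta_{N_t}-\mathbb{E}[X_{1,1}]\|^2\bigr]=0.$$ -/

import Mathlib

open MeasureTheory ProbabilityTheory Filter Topology

/-- The loss `ℓ(θ, x) = c ‖θ - x‖²` on `ℝ^d` with the Euclidean norm. -/
noncomputable def quadLoss {d : ℕ} (c : ℝ) (θ x : EuclideanSpace ℝ (Fin d)) : ℝ :=
  c * ‖θ - x‖ ^ 2

/-- A random variable with values in a topological space is non-degenerate if the (topological)
support of its distribution has non-empty interior. -/
def IsNondegenerate {Ω E : Type*} [MeasurableSpace Ω] [MeasurableSpace E] [TopologicalSpace E]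
    (X : Ω → E) (P : Measure Ω) : Prop :=
  (interior (P.map X).support).Nonempty

/-- `crossingIndex γ t ω = inf {n ∈ {0, 1, 2, …} : γ₁(ω) + ⋯ + γₙ(ω) ≥ t}`. -/
noncomputable def crossingIndex {Ω : Type*} (γ : ℕ → Ω → ℝ) (t : ℝ) (ω : Ω) : ℕ :=
  sInf {n : ℕ | t ≤ ∑ k ∈ Finset.Icc 1 n, γ k ω}

/-!
A gradient step with learning rate `γ` is the relaxation `Θ ↦ Θ + a • (x - Θ)` towards the mean
`x` of the training batch, with step size `a = 2 * c * γ`. All step sizes lie in `(0, α]` with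
`α = 2 * c * ν 1 < 2`, so each step contracts distances by the factor `|1 - a| < 1`.

*Boundedness.* For an i.i.d. sequence, a finite supremum forces the common law to have bounded
support (`iIndepFun.exists_ae_norm_le`). Hence every iterate is bounded by `‖Θ 0‖` plus a constant
(`norm_relax_le_max`), which dominates all expectations.

*The learning rates tend to zero almost surely.* They run through the values `ν k` in order, one
step for each increase of the test loss (`eq_rate_dropCount`). If the rate were eventually
constant, then a long block of training data near an interior point `z` of the support would bring
the iterate close to `z`; training data near `z + p` followed by test data near `z - p` would then
increase the test loss. Such blocks are independent events with probability bounded below, so by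
Borel–Cantelli they occur infinitely often (`ae_tendsto_dropCount`).

*Convergence.* In the time scale `∑ a`, the squared distance to the mean decays exponentially up
to a martingale term and a term quadratic in `a` (`exp_mul_norm_sub_sq_le`). The learning rate of
the next step is known before its data, so stopping at the first passage of `∑ a` over a level `τ`
keeps the martingale term centred. As the rate has dropped at most `n` times after `n` steps, the
passage happens before a deterministic time. What remains is an exponentially weighted average of
the step sizes, which is bounded and tends to zero almost surely
(`tendsto_sum_exp_mul_sq_div_exp`), hence in mean.
-/

/-! ### Relaxation recursions -/

section Relaxation
variable {E : Type*} [NormedAddCommGroup E] [InnerProductSpace ℝ E]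

/-- The contraction `1 - |1 - a|` gained in one step dominates the step size `a`, uniformly for
`a ≤ α < 2`. The constant `2 / (2 - α)` is therefore the factor by which perturbations of the
targets can be amplified in the long run. -/
lemma le_one_sub_abs_mul {a α : ℝ} (ha : 0 ≤ a) (haα : a ≤ α) (hα : α < 2) :
    a ≤ (1 - |1 - a|) * (2 / (2 - α)) := by
  have h2 : 0 < 2 - α := by linarith
  rw [← mul_div_assoc, le_div_iff₀ h2]
  rcases le_total a 1 with h | h
  · rw [abs_of_nonneg (by linarith)]; nlinarith
  · rw [abs_of_nonpos (by linarith)]; nlinarith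

lemma norm_relax_sub_le (a : ℝ) (ha : 0 ≤ a) (θ x z : E) :
    ‖θ + a • (x - θ) - z‖ ≤ |1 - a| * ‖θ - z‖ + a * ‖x - z‖ := by
  have : θ + a • (x - θ) - z = (1 - a) • (θ - z) + a • (x - z) := by module
  rw [this]
  refine (norm_add_le _ _).trans ?_
  rw [norm_smul, norm_smul, Real.norm_eq_abs, Real.norm_eq_abs, abs_of_nonneg ha]

lemma norm_relax_le_max {θ x : ℕ → E} {a : ℕ → ℝ} {α B : ℝ} (hα : α < 2)
    (hθ : ∀ n, θ (n + 1) = θ n + a n • (x n - θ n)) (ha : ∀ n, 0 ≤ a n) (haα : ∀ n, a n ≤ α)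
    (hx : ∀ n, ‖x n‖ ≤ B) (n : ℕ) : ‖θ n‖ ≤ max ‖θ 0‖ (2 / (2 - α) * B) := by
  induction n with
  | zero => exact le_max_left _ _
  | succ n ih =>
    have h1 := norm_relax_sub_le (a n) (ha n) (θ n) (x n) 0
    simp only [sub_zero, ← hθ] at h1
    have h2 := le_one_sub_abs_mul (ha n) (haα n) hα
    have h3 : |1 - a n| ≤ 1 := by
      rw [abs_le]; constructor <;> linarith [ha n, haα n]
    set T := max ‖θ 0‖ (2 / (2 - α) * B)
    calc ‖θ (n + 1)‖ ≤ |1 - a n| * ‖θ n‖ + a n * ‖x n‖ := h1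
      _ ≤ |1 - a n| * T + ((1 - |1 - a n|) * (2 / (2 - α))) * B := by
          gcongr
          exact hx n
      _ = |1 - a n| * T + (1 - |1 - a n|) * (2 / (2 - α) * B) := by ring
      _ ≤ |1 - a n| * T + (1 - |1 - a n|) * T := by
          gcongr
          exact le_max_right _ _
      _ = T := by ring

lemma norm_relax_sub_le_pow {θ x : ℕ → E} {a α ε : ℝ} (hα : α < 2) (ha : 0 ≤ a) (haα : a ≤ α)
    (z : E) (n K : ℕ) (hε : 0 ≤ ε)
    (hθ : ∀ i < K, θ (n + i + 1) = θ (n + i) + a • (x (n + i) - θ (n + i)))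
    (hx : ∀ i < K, ‖x (n + i) - z‖ ≤ ε) :
    ‖θ (n + K) - z‖ ≤ |1 - a| ^ K * ‖θ n - z‖ + 2 / (2 - α) * ε := by
  induction K with
  | zero =>
    have : 0 < 2 - α := by linarith
    simp only [add_zero, pow_zero, one_mul, le_add_iff_nonneg_right]
    positivity
  | succ K ih =>
    have ih := ih (fun i hi => hθ i (by omega)) (fun i hi => hx i (by omega))
    have h1 := norm_relax_sub_le a ha (θ (n + K)) (x (n + K)) z
    rw [← hθ K (by omega)] at h1
    have h2 := le_one_sub_abs_mul ha haα hα
    calc ‖θ (n + (K + 1)) - z‖ ≤ |1 - a| * ‖θ (n + K) - z‖ + a * ‖x (n + K) - z‖ := h1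
      _ ≤ |1 - a| * (|1 - a| ^ K * ‖θ n - z‖ + 2 / (2 - α) * ε)
            + ((1 - |1 - a|) * (2 / (2 - α))) * ε := by
          gcongr
          · linarith
          · exact hx K (by omega)
      _ = |1 - a| ^ (K + 1) * ‖θ n - z‖ + 2 / (2 - α) * ε := by ring

/-- If `θ` is close to `z`, then a step towards a point near `z + p` increases the distance to
every point near `z - p`. -/
lemma norm_sub_lt_norm_relax_sub {a : ℝ} (ha : 0 < a) {θ x y z p : E} (hp : p ≠ 0)
    (hθ : ‖θ - z‖ ≤ ‖p‖ / 8) (hx : ‖x - (z + p)‖ ≤ ‖p‖ / 8) (hy : ‖y - (z - p)‖ ≤ ‖p‖ / 8) :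
    ‖θ - y‖ < ‖θ + a • (x - θ) - y‖ := by
  have hp0 : 0 < ‖p‖ := norm_pos_iff.2 hp
  obtain ⟨s, hs⟩ : ∃ s, s = (x - (z + p)) - (θ - z) := ⟨_, rfl⟩
  obtain ⟨r, hr⟩ : ∃ r, r = (θ - z) - (y - (z - p)) := ⟨_, rfl⟩
  have hs' : ‖s‖ ≤ ‖p‖ / 4 := by
    rw [hs]; refine (norm_sub_le _ _).trans ?_; linarith
  have hr' : ‖r‖ ≤ ‖p‖ / 4 := by
    rw [hr]; refine (norm_sub_le _ _).trans ?_; linarith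
  have h1 : x - θ = p + s := by rw [hs]; abel
  have h2 : θ - y = p + r := by rw [hr]; abel
  have h3 : θ + a • (x - θ) - y = (θ - y) + a • (x - θ) := by abel
  have hin : 0 < inner ℝ (p + r) (p + s) := by
    rw [inner_add_left, inner_add_right, inner_add_right, real_inner_self_eq_norm_sq]
    have e1 := neg_le_of_abs_le (abs_real_inner_le_norm p s)
    have e2 := neg_le_of_abs_le (abs_real_inner_le_norm r p)
    have e3 := neg_le_of_abs_le (abs_real_inner_le_norm r s)
    nlinarith [norm_nonneg r, norm_nonneg s, mul_le_mul hr' hs' (norm_nonneg _) (by positivity)]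
  rw [h3, h1, h2]
  refine lt_of_pow_lt_pow_left₀ 2 (norm_nonneg _) ?_
  rw [norm_add_sq_real (p + r) (a • (p + s)), inner_smul_right]
  have : 0 ≤ ‖a • (p + s)‖ ^ 2 := by positivity
  have := mul_pos ha hin
  linarith

lemma norm_average_sub_le {M : ℕ} (hM : 1 ≤ M) {x : ℕ → E} {z : E} {ε : ℝ}
    (h : ∀ m ∈ Finset.Icc 1 M, ‖x m - z‖ ≤ ε) :
    ‖(M : ℝ)⁻¹ • ∑ m ∈ Finset.Icc 1 M, x m - z‖ ≤ ε := by
  have hM0 : (0 : ℝ) < M := by exact_mod_cast hM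
  have h1 : (M : ℝ)⁻¹ • ∑ m ∈ Finset.Icc 1 M, x m - z =
      (M : ℝ)⁻¹ • ∑ m ∈ Finset.Icc 1 M, (x m - z) := by
    rw [Finset.sum_sub_distrib, smul_sub]
    simp [← Nat.cast_smul_eq_nsmul ℝ, smul_smul, hM0.ne']
  rw [h1, norm_smul, Real.norm_of_nonneg (by positivity), inv_mul_le_iff₀ hM0]
  refine (norm_sum_le_of_le _ h).trans (le_of_eq ?_)
  simp

/-- With a constant step size, `K` targets near `z` bring the iterate close to `z`; one further
target near `z + p` then increases the distance to every point near `z - p`. -/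
lemma norm_sub_lt_of_block {θ x : ℕ → E} {a α ε : ℝ} (ha : 0 < a) (haα : a ≤ α) (hα : α < 2)
    {z p y : E} (hp : p ≠ 0) (hε : 0 ≤ ε) (hεp : (1 + 2 / (2 - α)) * ε ≤ ‖p‖ / 8) (n K : ℕ)
    (hθ : ∀ i ≤ K, θ (n + i + 1) = θ (n + i) + a • (x (n + i) - θ (n + i)))
    (hx : ∀ i < K, ‖x (n + i) - z‖ ≤ ε) (hxK : ‖x (n + K) - (z + p)‖ ≤ ε)
    (hK : |1 - a| ^ K * ‖θ n - z‖ ≤ ε) (hy : ‖y - (z - p)‖ ≤ ε) :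
    ‖θ (n + K) - y‖ < ‖θ (n + K + 1) - y‖ := by
  have hL : 0 < 2 - α := by linarith
  have hε' : ε ≤ ‖p‖ / 8 := by
    refine le_trans (le_mul_of_one_le_left hε ?_) hεp
    have : 0 ≤ 2 / (2 - α) := by positivity
    linarith
  have h1 := norm_relax_sub_le_pow hα ha.le haα z n K hε (fun i hi => hθ i hi.le) hx
  rw [hθ K le_rfl]
  exact norm_sub_lt_norm_relax_sub ha hp (by linarith) (hxK.trans hε') (hy.trans hε')

/-- The energy inequality: since `(1 - a)² ≤ exp (-(2 - α) a)` for `0 ≤ a ≤ α`, the squared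
distance weighted by the exponential of the elapsed time `∑ a` grows only through the noise terms.
-/
lemma exp_mul_norm_sub_sq_le {θ x : ℕ → E} {a : ℕ → ℝ} {α : ℝ}
    (hθ : ∀ n, θ (n + 1) = θ n + a n • (x n - θ n)) (ha : ∀ n, 0 ≤ a n) (haα : ∀ n, a n ≤ α)
    (z : E) (n : ℕ) :
    Real.exp ((2 - α) * ∑ k ∈ Finset.range n, a k) * ‖θ n - z‖ ^ 2 ≤ ‖θ 0 - z‖ ^ 2 +
      ∑ k ∈ Finset.range n, Real.exp ((2 - α) * ∑ j ∈ Finset.range (k + 1), a j) *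
        (2 * ((1 - a k) * a k) * inner ℝ (θ k - z) (x k - z) + a k ^ 2 * ‖x k - z‖ ^ 2) := by
  induction n with
  | zero => simp
  | succ n ih =>
    rw [Finset.sum_range_succ (fun k => Real.exp _ * _), ← add_assoc]
    have e : θ (n + 1) - z = (1 - a n) • (θ n - z) + a n • (x n - z) := by rw [hθ]; module
    have e2 : ‖θ (n + 1) - z‖ ^ 2 = (1 - a n) ^ 2 * ‖θ n - z‖ ^ 2 +
        (2 * ((1 - a n) * a n) * inner ℝ (θ n - z) (x n - z) + a n ^ 2 * ‖x n - z‖ ^ 2) := by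
      rw [e, norm_add_sq_real, norm_smul, norm_smul, inner_smul_left, inner_smul_right, mul_pow,
        mul_pow, Real.norm_eq_abs, Real.norm_eq_abs, sq_abs, sq_abs]
      simp only [conj_trivial]
      ring
    rw [e2, mul_add]
    gcongr
    refine le_trans ?_ ih
    rw [← mul_assoc]
    gcongr
    rw [Finset.sum_range_succ, mul_add, Real.exp_add, mul_assoc]
    refine mul_le_of_le_one_right (Real.exp_pos _).le ?_
    have h1 : (1 - a n) ^ 2 ≤ Real.exp (-((2 - α) * a n)) := by
      have := Real.add_one_le_exp (-((2 - α) * a n))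
      nlinarith [ha n, haα n]
    calc _ ≤ Real.exp ((2 - α) * a n) * Real.exp (-((2 - α) * a n)) := by gcongr
      _ = 1 := by rw [← Real.exp_add]; simp

/-! ### Exponentially weighted averages -/

/-- The summand of a right-endpoint Riemann sum of `exp (κ s)` is comparable to the increment of
the exponential, because consecutive nodes are at most `α` apart. -/
lemma norm_exp_mul_le {a : ℕ → ℝ} {κ α : ℝ} (hκ : 0 < κ) (ha : ∀ n, 0 ≤ a n)
    (haα : ∀ n, a n ≤ α) (n : ℕ) :
    ‖Real.exp (κ * ∑ j ∈ Finset.range (n + 1), a j) * a n‖ ≤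
      Real.exp (κ * α) / κ * (Real.exp (κ * ∑ j ∈ Finset.range (n + 1), a j) -
        Real.exp (κ * ∑ j ∈ Finset.range n, a j)) := by
  rw [Real.norm_of_nonneg (by have := ha n; positivity)]
  rw [Finset.sum_range_succ, mul_add, Real.exp_add]
  set e := Real.exp (κ * ∑ j ∈ Finset.range n, a j)
  have he : 0 < e := Real.exp_pos _
  have h1 := Real.add_one_le_exp (κ * a n)
  have h2 : Real.exp (κ * a n) ≤ Real.exp (κ * α) := by gcongr; exact haα n
  calc e * Real.exp (κ * a n) * a n ≤ e * Real.exp (κ * α) * a n := by gcongr; exact ha n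
    _ = Real.exp (κ * α) / κ * (e * (κ * a n)) := by field_simp
    _ ≤ Real.exp (κ * α) / κ * (e * (Real.exp (κ * a n) - 1)) := by gcongr; linarith
    _ = _ := by ring

lemma sum_exp_mul_sq_div_exp_le {a : ℕ → ℝ} {κ α : ℝ} (hκ : 0 < κ) (ha : ∀ n, 0 ≤ a n)
    (haα : ∀ n, a n ≤ α) (n : ℕ) :
    (∑ k ∈ Finset.range n, Real.exp (κ * ∑ j ∈ Finset.range (k + 1), a j) * a k ^ 2) /
        Real.exp (κ * ∑ j ∈ Finset.range n, a j) ≤ α * (Real.exp (κ * α) / κ) := by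
  have hα : 0 ≤ α := (ha 0).trans (haα 0)
  rw [div_le_iff₀ (Real.exp_pos _)]
  calc _ ≤ ∑ k ∈ Finset.range n, α * (Real.exp (κ * α) / κ *
          (Real.exp (κ * ∑ j ∈ Finset.range (k + 1), a j) -
            Real.exp (κ * ∑ j ∈ Finset.range k, a j))) := by
        refine Finset.sum_le_sum fun k _ => ?_
        have h := (le_abs_self _).trans (norm_exp_mul_le hκ ha haα k)
        refine le_trans ?_ (mul_le_mul_of_nonneg_left h hα)
        have := mul_le_mul_of_nonneg_right (haα k) (mul_nonneg
          (Real.exp_pos (κ * ∑ j ∈ Finset.range (k + 1), a j)).le (ha k))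
        nlinarith
    _ = α * (Real.exp (κ * α) / κ) * (Real.exp (κ * ∑ j ∈ Finset.range n, a j) - 1) := by
        rw [← Finset.mul_sum, ← Finset.mul_sum,
          Finset.sum_range_sub (fun k => Real.exp (κ * ∑ j ∈ Finset.range k, a j))]
        simp [mul_assoc]
    _ ≤ _ := by
        gcongr
        linarith

/-- The exponentially weighted average of `a` in the time scale `∑ a` tends to zero with `a`. -/
lemma tendsto_sum_exp_mul_sq_div_exp {a : ℕ → ℝ} {κ α : ℝ} (hκ : 0 < κ) (ha : ∀ n, 0 ≤ a n)
    (haα : ∀ n, a n ≤ α) (hlim : Tendsto a atTop (𝓝 0))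
    (hsum : Tendsto (fun n => ∑ k ∈ Finset.range n, a k) atTop atTop) :
    Tendsto (fun n => (∑ k ∈ Finset.range n,
      Real.exp (κ * ∑ j ∈ Finset.range (k + 1), a j) * a k ^ 2) /
        Real.exp (κ * ∑ j ∈ Finset.range n, a j)) atTop (𝓝 0) := by
  have hexp : Tendsto (fun n => Real.exp (κ * ∑ j ∈ Finset.range n, a j)) atTop atTop :=
    Real.tendsto_exp_atTop.comp (hsum.const_mul_atTop hκ)
  set e : ℕ → ℝ := fun n => Real.exp (κ * ∑ j ∈ Finset.range n, a j) with he
  have hmono : ∀ n, 0 ≤ e (n + 1) - e n := by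
    intro n
    have : e n ≤ e (n + 1) := by
      simp only [he]
      rw [Finset.sum_range_succ]
      gcongr
      exact le_add_of_nonneg_right (ha n)
    linarith
  have h1 : (fun n => e (n + 1) * a n) =O[atTop] fun n => e (n + 1) - e n :=
    Asymptotics.IsBigO.of_bound (Real.exp (κ * α) / κ) (Eventually.of_forall fun n => by
      rw [Real.norm_of_nonneg (hmono n)]; exact norm_exp_mul_le hκ ha haα n)
  have h2 : (fun n => e (n + 1) * a n ^ 2) =o[atTop] fun n => e (n + 1) - e n := by
    have := h1.mul_isLittleO ((Asymptotics.isLittleO_one_iff ℝ).2 hlim)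
    refine this.congr (fun n => by ring) (fun n => by ring)
  have hs : ∀ n, ∑ k ∈ Finset.range n, (e (k + 1) - e k) = e n - 1 := by
    intro n; rw [Finset.sum_range_sub]; simp [he]
  have h3 := h2.sum_range hmono (by
    simp only [hs]; exact tendsto_atTop_add_const_right _ (-1) hexp)
  simp only [hs] at h3
  have h4 : (fun n => e n - 1) =O[atTop] e :=
    Asymptotics.IsBigO.of_bound 1 (Eventually.of_forall fun n => by
      have h1e : 1 ≤ e n := Real.one_le_exp (mul_nonneg hκ.le (Finset.sum_nonneg fun i _ => ha i))
      rw [Real.norm_of_nonneg (by linarith), Real.norm_of_nonneg (by linarith)]; linarith)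
  exact (h3.trans_isBigO h4).tendsto_div_nhds_zero

end Relaxation

/-! ### Independence and recurrence -/

section Independence
variable {Ω ι E : Type*} [MeasurableSpace Ω] [MeasurableSpace E] {P : Measure Ω}

/-- A variable independent of a whole independent family can be adjoined to it, under the new
index `none`. -/
lemma ProbabilityTheory.iIndepFun.option_elim {X : ι → Ω → E} {Z : Ω → E} (hX : iIndepFun X P)
    (h : IndepFun (fun ω i => X i ω) Z P) :
    iIndepFun (fun o : Option ι => o.elim Z X) P := by
  classical
  have := hX.isProbabilityMeasure
  rw [iIndepFun_iff_measure_inter_preimage_eq_mul]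
  intro S A hA
  set T := Finset.eraseNone S with hT
  have hTA : ∀ i ∈ T, MeasurableSet (A (some i)) := fun i hi => hA _ (Finset.mem_eraseNone.1 hi)
  have hcyl : MeasurableSet {x : ι → E | ∀ i ∈ T, x i ∈ A (some i)} := by
    have : {x : ι → E | ∀ i ∈ T, x i ∈ A (some i)} =
        ⋂ i ∈ T, (fun x : ι → E => x i) ⁻¹' A (some i) := by ext; simp
    rw [this]
    exact Finset.measurableSet_biInter _ fun i hi => measurable_pi_apply i (hTA i hi)
  have hXT : P (⋂ i ∈ T, X i ⁻¹' A (some i)) = ∏ i ∈ T, P (X i ⁻¹' A (some i)) :=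
    hX.measure_inter_preimage_eq_mul T (sets := fun i => A (some i)) hTA
  have hpre : (fun ω i => X i ω) ⁻¹' {x : ι → E | ∀ i ∈ T, x i ∈ A (some i)} =
      ⋂ i ∈ T, X i ⁻¹' A (some i) := by ext; simp
  by_cases hn : none ∈ S
  · have hS : S = Finset.insertNone T := by
      rw [hT, Finset.insertNone_eraseNone, Finset.insert_eq_of_mem hn]
    have hI : (⋂ o ∈ S, (fun o : Option ι => o.elim Z X) o ⁻¹' A o) =
        (⋂ i ∈ T, X i ⁻¹' A (some i)) ∩ Z ⁻¹' A none := by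
      rw [hS]; ext ω; simp [Option.forall, and_comm]
    rw [hI, ← hpre, h.measure_inter_preimage_eq_mul _ _ hcyl (hA _ hn), hpre, hXT, hS,
      Finset.prod_insertNone, mul_comm]
    rfl
  · have hS : S = T.map Function.Embedding.some := by
      rw [hT, Finset.map_some_eraseNone, Finset.erase_eq_of_notMem hn]
    have hI : (⋂ o ∈ S, (fun o : Option ι => o.elim Z X) o ⁻¹' A o) =
        ⋂ i ∈ T, X i ⁻¹' A (some i) := by
      rw [hS]; ext ω; simp
    rw [hI, hXT, hS, Finset.prod_map]
    rfl

/-- The second Borel–Cantelli lemma for events that are determined by disjoint finite blocks of an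
independent family. -/
lemma ProbabilityTheory.iIndepFun.ae_frequently_forall_mem {X : ι → Ω → E} (hX : iIndepFun X P)
    (hmeas : ∀ i, Measurable (X i)) {U : ι → Set E} (hU : ∀ i, MeasurableSet (U i))
    {I : ℕ → Finset ι} (hI : Pairwise (fun j k => Disjoint (I j) (I k))) {q : ENNReal}
    (hq : q ≠ 0) (hqI : ∀ j, q ≤ ∏ i ∈ I j, P (X i ⁻¹' U i)) :
    ∀ᵐ ω ∂P, ∃ᶠ j in atTop, ∀ i ∈ I j, X i ω ∈ U i := by
  classical
  have := hX.isProbabilityMeasure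
  set A : ℕ → Set Ω := fun j => ⋂ i ∈ I j, X i ⁻¹' U i with hA
  have hAm : ∀ j, MeasurableSet (A j) := fun j =>
    Finset.measurableSet_biInter _ fun i _ => hmeas i (hU i)
  have hprod : ∀ T : Finset ι, P (⋂ i ∈ T, X i ⁻¹' U i) = ∏ i ∈ T, P (X i ⁻¹' U i) :=
    fun T => hX.measure_inter_preimage_eq_mul T (sets := U) fun i _ => hU i
  have hind : iIndepSet A P := by
    rw [iIndepSet_iff_meas_biInter hAm]
    intro s
    have h1 : ⋂ j ∈ s, A j = ⋂ i ∈ s.biUnion I, X i ⁻¹' U i := by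
      ext ω; simp only [hA, Set.mem_iInter, Finset.mem_biUnion]; aesop
    rw [h1, hprod, Finset.prod_biUnion fun j _ k _ hjk => hI hjk]
    exact Finset.prod_congr rfl fun j _ => (hprod _).symm
  have hsum : ∑' j, P (A j) = ⊤ := by
    refine top_unique ((ENNReal.tsum_const_eq_top_of_ne_zero (α := ℕ) hq).symm.trans_le ?_)
    exact ENNReal.tsum_le_tsum fun j => (hqI j).trans (hprod _).ge
  have h1 := measure_limsup_eq_one hAm hind hsum
  have h2 : ∀ᵐ ω ∂P, ω ∈ limsup A atTop :=
    (prob_compl_eq_zero_iff (MeasurableSet.measurableSet_limsup hAm)).2 h1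
  filter_upwards [h2] with ω hω
  rw [mem_limsup_iff_frequently_mem] at hω
  exact hω.mono fun j hj i hi => by
    simp only [hA, Set.mem_iInter] at hj
    exact hj i hi

/-- The supremum of an i.i.d. sequence is almost surely the essential supremum of one term; so if
it is finite, then the terms are almost surely bounded by a constant. -/
lemma ProbabilityTheory.iIndepFun.exists_ae_norm_le {E : Type*} [NormedAddCommGroup E]
    [MeasurableSpace E] [BorelSpace E] {Y : ℕ → Ω → E} (hY : iIndepFun Y P)
    (hmeas : ∀ n, Measurable (Y n))
    (hident : ∀ n, IdentDistrib (Y n) (Y 0) P P) (hsup : ∀ᵐ ω ∂P, ⨆ n, ‖Y n ω‖ₑ < ⊤) :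
    ∃ B : ℝ, ∀ᵐ ω ∂P, ‖Y 0 ω‖ ≤ B := by
  have := hY.isProbabilityMeasure
  by_contra! hcon
  have hU : ∀ b : ℝ, MeasurableSet {y : E | b < ‖y‖} := fun b =>
    measurableSet_lt measurable_const measurable_norm
  have hfreq : ∀ b : ℕ, ∀ᵐ ω ∂P, ∃ᶠ n in atTop, (b : ℝ) < ‖Y n ω‖ := by
    intro b
    have hb := hcon b
    have hq : P (Y 0 ⁻¹' {y : E | (b : ℝ) < ‖y‖}) ≠ 0 := by
      intro h0
      refine hb ?_
      rw [ae_iff]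
      simpa using h0
    have := hY.ae_frequently_forall_mem hmeas (U := fun _ => {y : E | (b : ℝ) < ‖y‖})
      (fun _ => hU b) (I := fun n => {n}) (fun j k hjk => by simpa using hjk) hq
      (fun j => by simpa using ((hident j).measure_mem_eq (hU b)).ge)
    simpa using this
  obtain ⟨ω, h1, h2⟩ := ((ae_all_iff.2 hfreq).and hsup).exists
  obtain ⟨b, hb⟩ := ENNReal.exists_nat_gt h2.ne
  obtain ⟨n, hn⟩ := (h1 b).exists
  have h3 : (b : ENNReal) < ‖Y n ω‖ₑ := by
    rw [← ofReal_norm, ← ENNReal.ofReal_natCast]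
    exact (ENNReal.ofReal_lt_ofReal_iff_of_nonneg (Nat.cast_nonneg b)).2 hn
  exact absurd (h3.trans_le (le_iSup (fun n => ‖Y n ω‖ₑ) n)) hb.le.not_gt

end Independence

/-! ### First passage of partial sums -/

/-- `firstPassage a τ` is the least `n` with `a 0 + ⋯ + a (n - 1) ≥ τ`, and `0` if there is none. -/
noncomputable def firstPassage (a : ℕ → ℝ) (τ : ℝ) : ℕ :=
  sInf {n : ℕ | τ ≤ ∑ k ∈ Finset.range n, a k}

section FirstPassage
variable {a : ℕ → ℝ}

lemma le_sum_firstPassage (hsum : Tendsto (fun n => ∑ k ∈ Finset.range n, a k) atTop atTop)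
    (τ : ℝ) : τ ≤ ∑ k ∈ Finset.range (firstPassage a τ), a k :=
  Nat.sInf_mem (s := {n : ℕ | τ ≤ ∑ k ∈ Finset.range n, a k})
    (hsum.eventually_ge_atTop τ).exists

lemma lt_firstPassage_iff (ha : ∀ n, 0 ≤ a n)
    (hsum : Tendsto (fun n => ∑ k ∈ Finset.range n, a k) atTop atTop) {τ : ℝ} {n : ℕ} :
    n < firstPassage a τ ↔ ∑ k ∈ Finset.range n, a k < τ := by
  constructor
  · intro h
    simpa using Nat.notMem_of_lt_sInf h
  · intro h
    by_contra! hn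
    have : ∑ k ∈ Finset.range (firstPassage a τ), a k ≤ ∑ k ∈ Finset.range n, a k :=
      Finset.sum_le_sum_of_subset_of_nonneg (Finset.range_mono hn) fun i _ _ => ha i
    linarith [le_sum_firstPassage hsum τ]

lemma sum_firstPassage_le {α τ : ℝ} (ha : ∀ n, 0 ≤ a n) (haα : ∀ n, a n ≤ α) (hτ : 0 ≤ τ)
    (hsum : Tendsto (fun n => ∑ k ∈ Finset.range n, a k) atTop atTop) :
    ∑ k ∈ Finset.range (firstPassage a τ), a k ≤ τ + α := by
  rcases h : firstPassage a τ with _ | n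
  · simpa using add_nonneg hτ ((ha 0).trans (haα 0))
  · have := (lt_firstPassage_iff ha hsum).1 (show n < firstPassage a τ by omega)
    rw [Finset.sum_range_succ]
    linarith [haα n]

lemma tendsto_firstPassage (ha : ∀ n, 0 ≤ a n)
    (hsum : Tendsto (fun n => ∑ k ∈ Finset.range n, a k) atTop atTop) :
    Tendsto (firstPassage a) atTop atTop := by
  refine tendsto_atTop.2 fun n => ?_
  filter_upwards [eventually_gt_atTop (∑ k ∈ Finset.range n, a k)] with τ hτ
  exact ((lt_firstPassage_iff ha hsum).2 hτ).le

lemma measurable_firstPassage {Ω : Type*} [MeasurableSpace Ω] {a : ℕ → Ω → ℝ}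
    (hm : ∀ n, Measurable (a n)) (ha : ∀ n ω, 0 ≤ a n ω)
    (hsum : ∀ ω, Tendsto (fun n => ∑ k ∈ Finset.range n, a k ω) atTop atTop) (τ : ℝ) :
    Measurable fun ω => firstPassage (fun n => a n ω) τ := by
  refine measurable_of_Ioi fun n => ?_
  have : (fun ω => firstPassage (fun n => a n ω) τ) ⁻¹' Set.Ioi n =
      {ω | ∑ k ∈ Finset.range n, a k ω < τ} := by
    ext ω
    exact lt_firstPassage_iff (fun n => ha n ω) (hsum ω)
  rw [this]
  exact measurableSet_lt (Finset.measurable_fun_sum _ fun i _ => hm i) measurable_const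

end FirstPassage

/-! ### Mean-square convergence for adapted relaxation parameters -/

section Convergence
variable {Ω E : Type*} [mΩ : MeasurableSpace Ω] {P : Measure Ω} [IsProbabilityMeasure P]
  [NormedAddCommGroup E] [InnerProductSpace ℝ E] [CompleteSpace E] [MeasurableSpace E]
  [BorelSpace E]

/-- Orthogonality of an adapted vector and a centred independent one. -/
lemma integral_inner_eq_zero_of_indepFun {V x : Ω → E} (hV : Integrable V P) (hx : Integrable x P)
    (hind : IndepFun V x P) (z : E) (hz : ∫ ω, x ω ∂P = z) :
    Integrable (fun ω => inner ℝ (V ω) (x ω - z)) P ∧ ∫ ω, inner ℝ (V ω) (x ω - z) ∂P = 0 := by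
  have hind' : IndepFun V (fun ω => x ω - z) P :=
    hind.comp measurable_id (measurable_id.sub_const z)
  have hx' : Integrable (fun ω => x ω - z) P := hx.sub (integrable_const z)
  refine ⟨hind'.integrable_bilin hV hx' (innerSL ℝ), ?_⟩
  have h : ∫ ω, inner ℝ (V ω) (x ω - z) ∂P =
      inner ℝ (∫ ω, V ω ∂P) (∫ ω, (x ω - z) ∂P) := hind'.integral_bilin hV hx' (innerSL ℝ)
  rw [h, integral_sub hx (integrable_const z), hz]
  simp

variable [SecondCountableTopology E] {θ x : ℕ → Ω → E} {a : ℕ → Ω → ℝ} {α B : ℝ}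

/-- The expectation of the energy inequality at the first passage time. The event `k < N` that the
passage is still to come is `{∑ j < k, a j < τ}` and hence belongs to `F k`, so the noise terms
that are linear in `x k - z` have mean zero also when the sum is stopped at `N`. -/
lemma integral_norm_sq_firstPassage_le
    {F : ℕ → MeasurableSpace Ω} (hF : ∀ n, F n ≤ mΩ)
    (hθF : ∀ n, Measurable[F n] (θ n)) (haF : ∀ n k, k ≤ n → Measurable[F n] (a k))
    (hxm : ∀ n, Measurable (x n))
    (hind : ∀ n, Indep (F n) (MeasurableSpace.comap (x n) inferInstance) P)
    (z : E) (hxz : ∀ n, ∫ ω, x n ω ∂P = z)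
    (hxB : ∀ᵐ ω ∂P, ∀ n, ‖x n ω‖ ≤ B)
    (hα : α < 2) (ha : ∀ n ω, 0 ≤ a n ω) (haα : ∀ n ω, a n ω ≤ α)
    (hθ : ∀ n ω, θ (n + 1) ω = θ n ω + a n ω • (x n ω - θ n ω))
    (hint : ∀ n, Integrable (fun ω => ‖θ n ω - z‖) P)
    {b : ℕ → ℝ} (hb : ∀ n ω, b n ≤ a n ω)
    (hbsum : Tendsto (fun n => ∑ k ∈ Finset.range n, b k) atTop atTop)
    (τ : ℝ) (hτ : 0 ≤ τ)
    (hint0 : Integrable (fun ω => ‖θ 0 ω - z‖ ^ 2) P)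
    (hintN : Integrable (fun ω => ‖θ (firstPassage (fun n => a n ω) τ) ω - z‖ ^ 2) P)
    {r : Ω → ℝ} (hr : ∀ ω, r ω = (∑ k ∈ Finset.range (firstPassage (fun n => a n ω) τ),
      Real.exp ((2 - α) * ∑ j ∈ Finset.range (k + 1), a j ω) * a k ω ^ 2) /
        Real.exp ((2 - α) * ∑ j ∈ Finset.range (firstPassage (fun n => a n ω) τ), a j ω))
    (hrint : Integrable r P) :
    ∫ ω, ‖θ (firstPassage (fun n => a n ω) τ) ω - z‖ ^ 2 ∂P ≤
      Real.exp (-((2 - α) * τ)) * ∫ ω, ‖θ 0 ω - z‖ ^ 2 ∂P +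
        (B + ‖z‖) ^ 2 * Real.exp ((2 - α) * α) * ∫ ω, r ω ∂P := by
  have hκ : 0 < 2 - α := by linarith
  obtain ⟨ω₀⟩ : Nonempty Ω := by
    by_contra h
    rw [not_nonempty_iff] at h
    exact IsProbabilityMeasure.ne_zero P (Measure.eq_zero_of_isEmpty P)
  have hα0 : 0 ≤ α := (ha 0 ω₀).trans (haα 0 ω₀)
  have hsum : ∀ ω, Tendsto (fun n => ∑ k ∈ Finset.range n, a k ω) atTop atTop := fun ω =>
    tendsto_atTop_mono (fun n => Finset.sum_le_sum fun k _ => hb k ω) hbsum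
  set κ := 2 - α with hκdef
  set N : Ω → ℕ := fun ω => firstPassage (fun n => a n ω) τ with hN
  set A : ℕ → Ω → ℝ := fun n ω => ∑ k ∈ Finset.range n, a k ω with hA
  have haF' : ∀ n, ∀ k ≤ n + 1, Measurable[F n] (A k) := fun n k hk =>
    Finset.measurable_fun_sum _ fun i hi => haF n i (by have := Finset.mem_range.1 hi; omega)
  -- the sums reach `τ` after a deterministic number of steps
  obtain ⟨nτ, hnτ⟩ : ∃ n, τ ≤ ∑ k ∈ Finset.range n, b k := (hbsum.eventually_ge_atTop τ).exists
  have hNle : ∀ ω, N ω ≤ nτ := by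
    intro ω
    by_contra! h
    have := (lt_firstPassage_iff (fun n => ha n ω) (hsum ω)).1 h
    have h2 : ∑ k ∈ Finset.range nτ, b k ≤ ∑ k ∈ Finset.range nτ, a k ω :=
      Finset.sum_le_sum fun k _ => hb k ω
    linarith
  -- the predictable factor of the `k`-th noise term, switched off after the passage
  set V : ℕ → Ω → E := fun k ω => ({ω | A k ω < τ}.indicator
    (fun ω => Real.exp (κ * A (k + 1) ω) * (2 * ((1 - a k ω) * a k ω))) ω) • (θ k ω - z) with hV
  have hVF : ∀ k, Measurable[F k] (V k) := by
    intro k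
    have hs : MeasurableSet[F k] {ω | A k ω < τ} :=
      measurableSet_lt (haF' k k (by omega)) measurable_const
    have h1 := haF' k (k + 1) le_rfl
    have h2 := haF k k le_rfl
    refine Measurable.smul (Measurable.indicator ?_ hs) ((hθF k).sub_const z)
    exact (Real.measurable_exp.comp (h1.const_mul κ)).mul
      (((measurable_const.sub h2).mul h2).const_mul 2)
  have hVint : ∀ k, Integrable (V k) P := by
    intro k
    refine ((hint k).const_mul (Real.exp (κ * (τ + α)) * (2 * ((1 + α) * α)))).mono'
      ((hVF k).mono (hF k) le_rfl).aestronglyMeasurable (Eventually.of_forall fun ω => ?_)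
    rw [hV, norm_smul]
    gcongr
    by_cases h : A k ω < τ
    · rw [Set.indicator_of_mem (by exact h), norm_mul, Real.norm_of_nonneg (Real.exp_pos _).le]
      have h1 : A (k + 1) ω ≤ τ + α := by
        simp only [hA] at h ⊢
        rw [Finset.sum_range_succ]
        linarith [haα k ω]
      have h2 : |1 - a k ω| ≤ 1 + α := by
        rw [abs_le]; constructor <;> linarith [ha k ω, haα k ω]
      rw [norm_mul, norm_mul, Real.norm_two, Real.norm_eq_abs, Real.norm_of_nonneg (ha k ω)]
      gcongr
      · exact mul_nonneg zero_le_two (mul_nonneg (abs_nonneg _) (ha k ω))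
      · exact ha k ω
      · exact haα k ω
    · rw [Set.indicator_of_notMem (by exact h), norm_zero]
      positivity
  have hxint : ∀ k, Integrable (x k) P := fun k =>
    Integrable.of_bound (hxm k).aestronglyMeasurable B (hxB.mono fun ω h => h k)
  have hcross := fun k => integral_inner_eq_zero_of_indepFun (hVint k) (hxint k)
    ((IndepFun_iff_Indep _ _ _).2 (indep_of_indep_of_le_left (hind k)
      (hVF k).comap_le)) z (hxz k)
  have hpath : ∀ᵐ ω ∂P, ‖θ (N ω) ω - z‖ ^ 2 ≤ Real.exp (-(κ * τ)) * (‖θ 0 ω - z‖ ^ 2 +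
      ∑ k ∈ Finset.range nτ, inner ℝ (V k ω) (x k ω - z)) +
        (B + ‖z‖) ^ 2 * Real.exp (κ * α) * r ω := by
    filter_upwards [hxB] with ω hω
    have h1 := exp_mul_norm_sub_sq_le (θ := fun n => θ n ω) (x := fun n => x n ω)
      (a := fun n => a n ω) (fun n => hθ n ω) (fun n => ha n ω) (fun n => haα n ω) z (N ω)
    simp only [mul_add, Finset.sum_add_distrib] at h1
    have h2 : ∑ k ∈ Finset.range (N ω), Real.exp (κ * A (k + 1) ω) *
        (2 * ((1 - a k ω) * a k ω) * inner ℝ (θ k ω - z) (x k ω - z)) =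
          ∑ k ∈ Finset.range nτ, inner ℝ (V k ω) (x k ω - z) := by
      rw [← Finset.sum_subset (Finset.range_mono (hNle ω))]
      · refine Finset.sum_congr rfl fun k hk => ?_
        have : A k ω < τ :=
          (lt_firstPassage_iff (fun n => ha n ω) (hsum ω)).1 (Finset.mem_range.1 hk)
        simp only [hV]
        rw [Set.indicator_of_mem (by exact this), real_inner_smul_left, ← mul_assoc]
      · intro k _ hk
        have : ¬ A k ω < τ := fun h =>
          hk (Finset.mem_range.2 ((lt_firstPassage_iff (fun n => ha n ω) (hsum ω)).2 h))
        simp only [hV]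
        rw [Set.indicator_of_notMem (by exact this), zero_smul, inner_zero_left]
    have h3 : ∑ k ∈ Finset.range (N ω), Real.exp (κ * A (k + 1) ω) *
        (a k ω ^ 2 * ‖x k ω - z‖ ^ 2) ≤
          (B + ‖z‖) ^ 2 * (r ω * Real.exp (κ * A (N ω) ω)) := by
      rw [hr, div_mul_cancel₀ _ (Real.exp_pos _).ne', Finset.mul_sum]
      refine Finset.sum_le_sum fun k _ => ?_
      have : ‖x k ω - z‖ ≤ B + ‖z‖ := (norm_sub_le _ _).trans (by linarith [hω k])
      have h4 : ‖x k ω - z‖ ^ 2 ≤ (B + ‖z‖) ^ 2 := by gcongr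
      have := mul_le_mul_of_nonneg_left h4
        (mul_nonneg (Real.exp_pos (κ * A (k + 1) ω)).le (sq_nonneg (a k ω)))
      simp only [hA] at this ⊢
      linarith
    have hr0 : 0 ≤ r ω := by
      rw [hr]
      exact div_nonneg (Finset.sum_nonneg fun k _ => by positivity) (Real.exp_pos _).le
    have h5 : τ ≤ A (N ω) ω := le_sum_firstPassage (hsum ω) τ
    have h6 : A (N ω) ω ≤ τ + α :=
      sum_firstPassage_le (fun n => ha n ω) (fun n => haα n ω) hτ (hsum ω)
    have h7 : Real.exp (κ * τ) * ‖θ (N ω) ω - z‖ ^ 2 ≤ (‖θ 0 ω - z‖ ^ 2 +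
        ∑ k ∈ Finset.range nτ, inner ℝ (V k ω) (x k ω - z)) +
          (B + ‖z‖) ^ 2 * (r ω * Real.exp (κ * (τ + α))) := by
      calc _ ≤ Real.exp (κ * A (N ω) ω) * ‖θ (N ω) ω - z‖ ^ 2 := by gcongr
        _ ≤ _ := h1
        _ ≤ (‖θ 0 ω - z‖ ^ 2 + ∑ k ∈ Finset.range nτ, inner ℝ (V k ω) (x k ω - z)) +
          (B + ‖z‖) ^ 2 * (r ω * Real.exp (κ * A (N ω) ω)) := by
            rw [← add_assoc, ← h2]
            gcongr
        _ ≤ _ := by gcongr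
    have h8 := mul_le_mul_of_nonneg_left h7 (Real.exp_pos (-(κ * τ))).le
    have h9 : Real.exp (-(κ * τ)) * Real.exp (κ * τ) = 1 := by rw [← Real.exp_add]; simp
    rw [mul_add κ τ α, Real.exp_add, ← mul_assoc, h9, one_mul] at h8
    refine h8.trans (le_of_eq ?_)
    linear_combination (B + ‖z‖) ^ 2 * r ω * Real.exp (κ * α) * h9
  have hI1 : Integrable (fun ω => ‖θ 0 ω - z‖ ^ 2 +
      ∑ k ∈ Finset.range nτ, inner ℝ (V k ω) (x k ω - z)) P :=
    hint0.add (integrable_finsetSum _ fun k _ => (hcross k).1)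
  refine (integral_mono_ae hintN ((hI1.const_mul _).add (hrint.const_mul _)) hpath).trans_eq ?_
  simp only [Pi.add_apply]
  rw [integral_add (hI1.const_mul _) (hrint.const_mul _), integral_const_mul, integral_const_mul,
    integral_add hint0 (integrable_finsetSum _ fun k _ => (hcross k).1),
    integral_finsetSum _ fun k _ => (hcross k).1]
  simp [fun k => (hcross k).2]

/-- A relaxation `θ (n + 1) = θ n + a n • (x n - θ n)` towards bounded targets `x n` with mean
`z`, each independent of the past, converges to `z` in mean square along the first passage times
of `∑ a`, provided that the adapted step sizes tend to zero and dominate a deterministic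
non-summable sequence. -/
theorem tendsto_integral_norm_sq_firstPassage
    {F : ℕ → MeasurableSpace Ω} (hF : ∀ n, F n ≤ mΩ)
    (hθF : ∀ n, Measurable[F n] (θ n)) (haF : ∀ n k, k ≤ n → Measurable[F n] (a k))
    (hxm : ∀ n, Measurable (x n))
    (hind : ∀ n, Indep (F n) (MeasurableSpace.comap (x n) inferInstance) P)
    (z : E) (hxz : ∀ n, ∫ ω, x n ω ∂P = z)
    (hxB : ∀ᵐ ω ∂P, ∀ n, ‖x n ω‖ ≤ B)
    (hα : α < 2) (ha : ∀ n ω, 0 ≤ a n ω) (haα : ∀ n ω, a n ω ≤ α)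
    (hθ : ∀ n ω, θ (n + 1) ω = θ n ω + a n ω • (x n ω - θ n ω))
    (hθ0 : MemLp (θ 0) 2 P)
    {b : ℕ → ℝ} (hb : ∀ n ω, b n ≤ a n ω)
    (hbsum : Tendsto (fun n => ∑ k ∈ Finset.range n, b k) atTop atTop)
    (hlim : ∀ᵐ ω ∂P, Tendsto (fun n => a n ω) atTop (𝓝 0)) :
    (∀ τ, Integrable (fun ω => ‖θ (firstPassage (fun n => a n ω) τ) ω - z‖ ^ 2) P) ∧
    Tendsto (fun τ => ∫ ω, ‖θ (firstPassage (fun n => a n ω) τ) ω - z‖ ^ 2 ∂P) atTop (𝓝 0) := by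
  have hκ : 0 < 2 - α := by linarith
  have hsum : ∀ ω, Tendsto (fun n => ∑ k ∈ Finset.range n, a k ω) atTop atTop := fun ω =>
    tendsto_atTop_mono (fun n => Finset.sum_le_sum fun k _ => hb k ω) hbsum
  have ham : ∀ n, Measurable (a n) := fun n => (haF n n le_rfl).mono (hF n) le_rfl
  have hθm : ∀ n, Measurable (θ n) := fun n => (hθF n).mono (hF n) le_rfl
  set N : ℝ → Ω → ℕ := fun τ ω => firstPassage (fun n => a n ω) τ with hN
  have hNm : ∀ τ, Measurable (N τ) := measurable_firstPassage ham ha hsum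
  have hcomp : ∀ {G : Type _} [MeasurableSpace G] (f : ℕ → Ω → G), (∀ n, Measurable (f n)) →
      ∀ τ, Measurable fun ω => f (N τ ω) ω := fun f hf τ =>
    (measurable_from_prod_countable_right (f := fun p : ℕ × Ω => f p.1 p.2) hf).comp
      ((hNm τ).prodMk measurable_id)
  -- all iterates are dominated by `‖θ 0‖` plus a constant
  obtain ⟨C, hC⟩ : ∃ C, C = |2 / (2 - α) * B| + ‖z‖ := ⟨_, rfl⟩
  have hC0 : 0 ≤ C := by rw [hC]; positivity
  have hdom : ∀ᵐ ω ∂P, ∀ n, ‖θ n ω - z‖ ≤ ‖θ 0 ω‖ + C := by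
    filter_upwards [hxB] with ω hω n
    have h1 := norm_relax_le_max (θ := fun n => θ n ω) (x := fun n => x n ω)
      (a := fun n => a n ω) hα (fun n => hθ n ω) (fun n => ha n ω) (fun n => haα n ω) hω n
    have h2 : max ‖θ 0 ω‖ (2 / (2 - α) * B) ≤ ‖θ 0 ω‖ + |2 / (2 - α) * B| :=
      max_le (le_add_of_nonneg_right (abs_nonneg _))
        ((le_abs_self _).trans (le_add_of_nonneg_left (norm_nonneg _)))
    have h3 := norm_sub_le (θ n ω) z
    rw [hC]
    linarith
  have hG1 : Integrable (fun ω => ‖θ 0 ω‖ + C) P :=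
    (hθ0.integrable (by norm_num)).norm.add (integrable_const C)
  have hG2 : Integrable (fun ω => (‖θ 0 ω‖ + C) ^ 2) P :=
    (hθ0.norm.add (memLp_const C)).integrable_sq
  have hint : ∀ n, Integrable (fun ω => ‖θ n ω - z‖) P := fun n =>
    hG1.mono' ((hθm n).sub_const z).norm.aestronglyMeasurable
      (hdom.mono fun ω h => by rw [norm_norm]; exact h n)
  have hint0 : Integrable (fun ω => ‖θ 0 ω - z‖ ^ 2) P :=
    hG2.mono' (((hθm 0).sub_const z).norm.pow_const 2).aestronglyMeasurable
      (hdom.mono fun ω h => by rw [norm_pow, norm_norm]; gcongr; exact h 0)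
  have hintN : ∀ τ, Integrable (fun ω => ‖θ (N τ ω) ω - z‖ ^ 2) P := fun τ =>
    hG2.mono' (hcomp (fun n ω => ‖θ n ω - z‖ ^ 2)
        (fun n => ((hθm n).sub_const z).norm.pow_const 2) τ).aestronglyMeasurable
      (hdom.mono fun ω h => by rw [norm_pow, norm_norm]; gcongr; exact h _)
  refine ⟨hintN, ?_⟩
  set ρ : ℕ → Ω → ℝ := fun n ω => (∑ k ∈ Finset.range n,
      Real.exp ((2 - α) * ∑ j ∈ Finset.range (k + 1), a j ω) * a k ω ^ 2) /
        Real.exp ((2 - α) * ∑ j ∈ Finset.range n, a j ω) with hρ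
  have hAm : ∀ n, Measurable fun ω => Real.exp ((2 - α) * ∑ j ∈ Finset.range n, a j ω) :=
    fun n => Real.measurable_exp.comp
      ((Finset.measurable_fun_sum _ fun i _ => ham i).const_mul _)
  have hρm : ∀ n, Measurable (ρ n) := fun n =>
    (Finset.measurable_fun_sum _ fun k _ => (hAm (k + 1)).mul ((ham k).pow_const 2)).div (hAm n)
  have hρb : ∀ n ω, ‖ρ n ω‖ ≤ α * (Real.exp ((2 - α) * α) / (2 - α)) := by
    intro n ω
    rw [Real.norm_of_nonneg
      (div_nonneg (Finset.sum_nonneg fun k _ => by positivity) (Real.exp_pos _).le)]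
    exact sum_exp_mul_sq_div_exp_le hκ (fun n => ha n ω) (fun n => haα n ω) n
  have hρint : ∀ τ, Integrable (fun ω => ρ (N τ ω) ω) P := fun τ =>
    Integrable.of_bound (hcomp ρ hρm τ).aestronglyMeasurable _
      (Eventually.of_forall fun ω => hρb _ ω)
  have hρlim : Tendsto (fun τ => ∫ ω, ρ (N τ ω) ω ∂P) atTop (𝓝 0) := by
    rw [← integral_zero Ω ℝ (μ := P)]
    refine tendsto_integral_filter_of_dominated_convergence
      (fun _ => α * (Real.exp ((2 - α) * α) / (2 - α)))
      (Eventually.of_forall fun τ => (hρint τ).aestronglyMeasurable)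
      (Eventually.of_forall fun τ => Eventually.of_forall fun ω => hρb _ ω)
      (integrable_const _) ?_
    filter_upwards [hlim] with ω hω
    exact (tendsto_sum_exp_mul_sq_div_exp hκ (fun n => ha n ω) (fun n => haα n ω) hω
      (hsum ω)).comp (tendsto_firstPassage (fun n => ha n ω) (hsum ω))
  have hexp : Tendsto (fun τ => Real.exp (-((2 - α) * τ))) atTop (𝓝 0) :=
    Real.tendsto_exp_neg_atTop_nhds_zero.comp (tendsto_id.const_mul_atTop hκ)
  have hup : Tendsto (fun τ => Real.exp (-((2 - α) * τ)) * ∫ ω, ‖θ 0 ω - z‖ ^ 2 ∂P +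
        (B + ‖z‖) ^ 2 * Real.exp ((2 - α) * α) * ∫ ω, ρ (N τ ω) ω ∂P) atTop (𝓝 0) := by
    simpa using (hexp.mul_const (∫ ω, ‖θ 0 ω - z‖ ^ 2 ∂P)).add
      (hρlim.const_mul ((B + ‖z‖) ^ 2 * Real.exp ((2 - α) * α)))
  refine tendsto_of_tendsto_of_tendsto_of_le_of_le' tendsto_const_nhds hup
    (Eventually.of_forall fun τ => integral_nonneg fun ω => sq_nonneg _) ?_
  filter_upwards [eventually_ge_atTop 0] with τ hτ
  exact integral_norm_sq_firstPassage_le hF hθF haF hxm hind z hxz hxB hα ha haα hθ hint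
    hb hbsum τ hτ hint0 (hintN τ) (fun ω => rfl) (hρint τ)

end Convergence

/-! ### The learning rate as a function of the number of drops -/

lemma sum_Icc_one_eq_sum_range {β : Type*} [AddCommMonoid β] (f : ℕ → β) (n : ℕ) :
    ∑ k ∈ Finset.Icc 1 n, f k = ∑ k ∈ Finset.range n, f (k + 1) := by
  induction n with
  | zero => simp
  | succ n ih => rw [Finset.sum_Icc_succ_top (by omega), ih, Finset.sum_range_succ]

section Rates
variable {ν : ℕ → ℝ}

lemma pos_of_strictAntiOn_of_tendsto_zero (hν : StrictAntiOn ν (Set.Ici 1))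
    (hlim : Tendsto ν atTop (𝓝 0)) {k : ℕ} (hk : 1 ≤ k) : 0 < ν k := by
  have h1 : ν (k + 1) < ν k := hν hk (by simp) (by omega)
  have h2 : 0 ≤ ν (k + 1) := by
    refine le_of_tendsto hlim ?_
    filter_upwards [eventually_ge_atTop (k + 1)] with m hm
    exact hν.antitoneOn (by simp) (show 1 ≤ m by omega) hm
  linarith

lemma eq_succ_of_isGreatest_Ioo_inter_image (hν : StrictAntiOn ν (Set.Ici 1))
    (hlim : Tendsto ν atTop (𝓝 0)) {k : ℕ} (hk : 1 ≤ k) {g : ℝ}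
    (hg : IsGreatest (Set.Ioo 0 (ν k) ∩ ν '' Set.Ici 1) g) : g = ν (k + 1) := by
  refine hg.unique ⟨⟨⟨pos_of_strictAntiOn_of_tendsto_zero hν hlim (by omega),
    hν hk (by simp) (by omega)⟩, ⟨k + 1, by simp, rfl⟩⟩, ?_⟩
  rintro _ ⟨⟨-, h2⟩, ⟨j, hj, rfl⟩⟩
  have : k < j := (hν.lt_iff_gt hj hk).1 h2
  exact hν.antitoneOn (by simp) hj this

end Rates

/-- The number of indices `k < n` for which the event `D k` occurs. -/
noncomputable def dropCount {Ω : Type*} (D : ℕ → Set Ω) (n : ℕ) (ω : Ω) : ℕ :=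
  ∑ k ∈ Finset.range n, (D k).indicator 1 ω

section DropCount
variable {Ω : Type*} {D : ℕ → Set Ω} {ω : Ω} {n : ℕ}

lemma dropCount_succ_of_mem (h : ω ∈ D n) : dropCount D (n + 1) ω = dropCount D n ω + 1 := by
  simp [dropCount, Finset.sum_range_succ, h]

lemma dropCount_succ_of_notMem (h : ω ∉ D n) : dropCount D (n + 1) ω = dropCount D n ω := by
  simp [dropCount, Finset.sum_range_succ, h]

lemma dropCount_le (D : ℕ → Set Ω) (n : ℕ) (ω : Ω) : dropCount D n ω ≤ n := by
  refine (Finset.sum_le_card_nsmul _ _ 1 fun k _ => ?_).trans (by simp)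
  exact Set.indicator_le_self' (fun _ _ => zero_le_one) ω

lemma dropCount_mono (D : ℕ → Set Ω) (ω : Ω) : Monotone fun n => dropCount D n ω :=
  monotone_nat_of_le_succ fun n => by simp [dropCount, Finset.sum_range_succ]

end DropCount

/-- If the rate moves to the largest smaller admissible value exactly on the events `D n`, then it
is always the admissible value whose index is one more than the number of drops so far. -/
lemma eq_rate_dropCount {Ω : Type*} {D : ℕ → Set Ω} {γ : ℕ → Ω → ℝ} {ν : ℕ → ℝ}
    (hν : StrictAntiOn ν (Set.Ici 1)) (hlim : Tendsto ν atTop (𝓝 0))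
    (hγ_one : ∀ ω, γ 1 ω = ν 1)
    (hkeep : ∀ n ω, ω ∉ D n → γ (n + 2) ω = γ (n + 1) ω)
    (hdrop : ∀ n ω, ω ∈ D n →
      IsGreatest (Set.Ioo 0 (γ (n + 1) ω) ∩ ν '' Set.Ici 1) (γ (n + 2) ω))
    (n : ℕ) (ω : Ω) : γ (n + 1) ω = ν (dropCount D n ω + 1) := by
  induction n with
  | zero => simpa [dropCount] using hγ_one ω
  | succ n ih =>
    by_cases h : ω ∈ D n
    · have := hdrop n ω h
      rw [ih] at this
      rw [dropCount_succ_of_mem h]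
      exact eq_succ_of_isGreatest_Ioo_inter_image hν hlim (by omega) this
    · rw [dropCount_succ_of_notMem h, hkeep n ω h, ih]

/-! ### Infinitely many drops of the learning rate -/

section Blocks
variable {Ω E : Type*} [MeasurableSpace Ω] {P : Measure Ω} [NormedAddCommGroup E]
  [MeasurableSpace E] [BorelSpace E]

/-- For every `K`, almost surely there are infinitely many disjoint blocks of `K + 1` steps such
that the training data of the first `K` steps are near `z₀`, and in the last step the training
data are near `z₁` and the test data near `z₂`. -/
lemma ae_frequently_block {X : ℤ → ℤ → Ω → E} (hmeas : ∀ n m, Measurable (X n m))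
    (hind : iIndepFun (fun p : ℤ × ℤ => X p.1 p.2) P)
    (hident : ∀ n m n' m', IdentDistrib (X n m) (X n' m') P P)
    {z₀ z₁ z₂ : E} {ε : ℝ} (h₀ : P (X 0 0 ⁻¹' Metric.ball z₀ ε) ≠ 0)
    (h₁ : P (X 0 0 ⁻¹' Metric.ball z₁ ε) ≠ 0) (h₂ : P (X 0 0 ⁻¹' Metric.ball z₂ ε) ≠ 0)
    (K M M' : ℕ) :
    ∀ᵐ ω ∂P, ∃ᶠ j : ℕ in atTop,
      (∀ i < K, ∀ m ∈ Finset.Icc 1 M,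
        ‖X ((j * (K + 1) + i + 1 : ℕ) : ℤ) (m : ℤ) ω - z₀‖ ≤ ε) ∧
      (∀ m ∈ Finset.Icc 1 M, ‖X ((j * (K + 1) + K + 1 : ℕ) : ℤ) (m : ℤ) ω - z₁‖ ≤ ε) ∧
      (∀ m ∈ Finset.Icc 1 M', ‖X ((j * (K + 1) + K + 1 : ℕ) : ℤ) (-(m : ℤ)) ω - z₂‖ ≤ ε) := by
  classical
  -- the target sets depend on the index only, not on the block: the last step of a block is the one
  -- divisible by `K + 1`, and training and test data differ in the sign of the second index
  set U : ℤ × ℤ → Set E := fun p => if ((K : ℤ) + 1) ∣ p.1 then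
    (if 0 < p.2 then Metric.ball z₁ ε else Metric.ball z₂ ε) else Metric.ball z₀ ε with hU
  set I : ℕ → Finset (ℤ × ℤ) := fun j =>
    Finset.Ioc ((j : ℤ) * (K + 1)) (((j : ℤ) + 1) * (K + 1)) ×ˢ Finset.Icc (-(M' : ℤ)) M with hI
  have hUm : ∀ p, MeasurableSet (U p) := by
    intro p
    simp only [hU]
    split_ifs <;> exact measurableSet_ball
  have hdisj : ∀ j k : ℕ, j < k → Disjoint (I j) (I k) := by
    intro j k hjk
    rw [Finset.disjoint_left]
    intro p hp hq
    simp only [hI, Finset.mem_product, Finset.mem_Ioc] at hp hq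
    have h1 : ((j : ℤ) + 1) * (K + 1) ≤ k * (K + 1) :=
      mul_le_mul_of_nonneg_right (by omega) (by omega)
    omega
  obtain ⟨q₀, hq₀⟩ : ∃ q₀, q₀ = min (P (X 0 0 ⁻¹' Metric.ball z₀ ε))
      (min (P (X 0 0 ⁻¹' Metric.ball z₁ ε)) (P (X 0 0 ⁻¹' Metric.ball z₂ ε))) := ⟨_, rfl⟩
  have hq₀0 : q₀ ≠ 0 := by
    rw [hq₀, ← pos_iff_ne_zero, lt_min_iff, lt_min_iff]
    exact ⟨pos_iff_ne_zero.2 h₀, pos_iff_ne_zero.2 h₁, pos_iff_ne_zero.2 h₂⟩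
  have hqU : ∀ p : ℤ × ℤ, q₀ ≤ P (X p.1 p.2 ⁻¹' U p) := by
    intro p
    rw [(hident p.1 p.2 0 0).measure_mem_eq (hUm p), hq₀]
    simp only [hU]
    split_ifs
    · exact (min_le_right _ _).trans (min_le_left _ _)
    · exact (min_le_right _ _).trans (min_le_right _ _)
    · exact min_le_left _ _
  have hcard : ∀ j, (I j).card = (K + 1) * (M + 1 + M') := by
    intro j
    simp only [hI, Finset.card_product, Int.card_Ioc, Int.card_Icc]
    congr 1
    · have : ((j : ℤ) + 1) * (K + 1) - j * (K + 1) = K + 1 := by ring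
      omega
    · omega
  have hfreq := hind.ae_frequently_forall_mem (fun p => hmeas p.1 p.2) hUm (I := I)
    (fun j k hjk => by
      rcases lt_or_gt_of_ne hjk with h | h
      · exact hdisj j k h
      · exact (hdisj k j h).symm)
    (pow_ne_zero ((K + 1) * (M + 1 + M')) hq₀0)
    (fun j => by
      rw [← hcard j, ← Finset.prod_const]
      exact Finset.prod_le_prod' fun p _ => hqU p)
  filter_upwards [hfreq] with ω hω
  refine hω.mono fun j hj => ?_
  have hmem : ∀ i ≤ K, ∀ m : ℤ, -(M' : ℤ) ≤ m → m ≤ M →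
      (((j * (K + 1) + i + 1 : ℕ) : ℤ), m) ∈ I j := by
    intro i hi m hm hm'
    simp only [hI, Finset.mem_product, Finset.mem_Ioc, Finset.mem_Icc]
    push_cast
    have : ((j : ℤ) + 1) * (K + 1) = j * (K + 1) + (K + 1) := by ring
    omega
  have hdvd : ((K : ℤ) + 1) ∣ ((j * (K + 1) + K + 1 : ℕ) : ℤ) := ⟨j + 1, by push_cast; ring⟩
  refine ⟨fun i hi m hm => ?_, fun m hm => ?_, fun m hm => ?_⟩
  · rw [Finset.mem_Icc] at hm
    have h := hj _ (hmem i hi.le m (by omega) (by omega))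
    have hnd : ¬ ((K : ℤ) + 1) ∣ ((j * (K + 1) + i + 1 : ℕ) : ℤ) := by
      intro hd
      have e : ((j * (K + 1) + i + 1 : ℕ) : ℤ) = (K + 1) * j + (i + 1) := by push_cast; ring
      rw [e, Int.dvd_add_right (Dvd.intro _ rfl)] at hd
      have := Int.le_of_dvd (by omega) hd
      omega
    simp only [hU, if_neg hnd, mem_ball_iff_norm] at h
    exact h.le
  · rw [Finset.mem_Icc] at hm
    have h := hj _ (hmem K le_rfl m (by omega) (by omega))
    simp only [hU, if_pos hdvd, if_pos (show (0 : ℤ) < m by omega), mem_ball_iff_norm] at h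
    exact h.le
  · rw [Finset.mem_Icc] at hm
    have h := hj _ (hmem K le_rfl (-(m : ℤ)) (by omega) (by omega))
    simp only [hU, if_pos hdvd, if_neg (show ¬ (0 : ℤ) < -(m : ℤ) by omega),
      mem_ball_iff_norm] at h
    exact h.le

lemma measure_preimage_ball_ne_zero {Y : Ω → E} (hY : Measurable Y) {z : E}
    (hz : z ∈ (P.map Y).support) {ε : ℝ} (hε : 0 < ε) : P (Y ⁻¹' Metric.ball z ε) ≠ 0 := by
  have := (Measure.mem_support_iff_forall z).1 hz _ (Metric.ball_mem_nhds z hε)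
  rw [Measure.map_apply hY measurableSet_ball] at this
  exact this.ne'

end Blocks

section Sgd

lemma gradient_quadLoss {d : ℕ} (c : ℝ) (θ x : EuclideanSpace ℝ (Fin d)) :
    gradient (fun θ => quadLoss c θ x) θ = (2 * c) • (θ - x) := by
  apply HasGradientAt.gradient
  rw [hasGradientAt_iff_hasFDerivAt]
  have h := (((hasFDerivAt_id (𝕜 := ℝ) θ).sub_const x).norm_sq).const_mul c
  refine h.congr_fderiv ?_
  ext y
  simp [mul_assoc]
  ring

variable {Ω : Type*} {d : ℕ}

/-- The event that the test loss strictly increases in the step from `Θ k` to `Θ (k + 1)`. -/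
def testLossIncrease (c : ℝ) (M' : ℕ) (X : ℤ → ℤ → Ω → EuclideanSpace ℝ (Fin d))
    (Θ : ℕ → Ω → EuclideanSpace ℝ (Fin d)) (k : ℕ) : Set Ω :=
  {ω | ∑ m ∈ Finset.Icc 1 M', quadLoss c (Θ k ω) (X ((k + 1 : ℕ) : ℤ) (-(m : ℤ)) ω) <
    ∑ m ∈ Finset.Icc 1 M', quadLoss c (Θ (k + 1) ω) (X ((k + 1 : ℕ) : ℤ) (-(m : ℤ)) ω)}

/-- The average of the training batch used in the step from `Θ n` to `Θ (n + 1)`. -/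
noncomputable def batchMean (M : ℕ) (X : ℤ → ℤ → Ω → EuclideanSpace ℝ (Fin d)) (n : ℕ) (ω : Ω) :
    EuclideanSpace ℝ (Fin d) :=
  (M : ℝ)⁻¹ • ∑ m ∈ Finset.Icc 1 M, X ((n + 1 : ℕ) : ℤ) (m : ℤ) ω

lemma measurable_batchMean {m₀ : MeasurableSpace Ω} {M n : ℕ}
    {X : ℤ → ℤ → Ω → EuclideanSpace ℝ (Fin d)}
    (h : ∀ m, Measurable[m₀] (X ((n + 1 : ℕ) : ℤ) m)) : Measurable[m₀] (batchMean M X n) :=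
  (Finset.measurable_fun_sum (Finset.Icc 1 M) fun (m : ℕ) _ => h (m : ℤ)).const_smul (M : ℝ)⁻¹

variable {c : ℝ} {M M' : ℕ} {X : ℤ → ℤ → Ω → EuclideanSpace ℝ (Fin d)}
  {Θ : ℕ → Ω → EuclideanSpace ℝ (Fin d)} {r : ℕ → ℝ}

lemma measurable_iterate_and_dropCount {F : ℕ → MeasurableSpace Ω} (hF : Monotone F)
    (hΘ0 : Measurable[F 0] (Θ 0)) (hX : ∀ (n : ℕ) (m : ℤ), Measurable[F n] (X (n : ℤ) m))
    (hΘ : ∀ n ω, Θ (n + 1) ω = Θ n ω +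
      r (dropCount (testLossIncrease c M' X Θ) n ω) • (batchMean M X n ω - Θ n ω)) (n : ℕ) :
    Measurable[F n] (Θ n) ∧ Measurable[F n] (dropCount (testLossIncrease c M' X Θ) n) := by
  induction n with
  | zero => exact ⟨hΘ0, measurable_const⟩
  | succ n ih =>
    let _ : MeasurableSpace Ω := F (n + 1)
    have h1 := ih.1.mono (hF n.le_succ) le_rfl
    have h2 := ih.2.mono (hF n.le_succ) le_rfl
    have h3 : Measurable[F (n + 1)] (Θ (n + 1)) := by
      rw [show Θ (n + 1) = fun ω => Θ n ω + r (dropCount (testLossIncrease c M' X Θ) n ω) •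
        (batchMean M X n ω - Θ n ω) from funext (hΘ n)]
      exact h1.add (((measurable_from_nat (f := r)).comp h2).smul
        ((measurable_batchMean (hX (n + 1))).sub h1))
    have h4 : ∀ {Y : Ω → EuclideanSpace ℝ (Fin d)}, Measurable[F (n + 1)] Y →
        Measurable[F (n + 1)] fun ω =>
          ∑ m ∈ Finset.Icc 1 M', quadLoss c (Y ω) (X ((n + 1 : ℕ) : ℤ) (-(m : ℤ)) ω) :=
      fun hY => Finset.measurable_fun_sum _ fun (m : ℕ) _ =>
        ((hY.sub (hX (n + 1) (-(m : ℤ)))).norm.pow_const 2).const_mul c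
    have h5 : MeasurableSet[F (n + 1)] (testLossIncrease c M' X Θ n) :=
      measurableSet_lt (h4 h1) (h4 h3)
    refine ⟨h3, ?_⟩
    rw [show dropCount (testLossIncrease c M' X Θ) (n + 1) = fun ω =>
      dropCount (testLossIncrease c M' X Θ) n ω + (testLossIncrease c M' X Θ n).indicator 1 ω from
        funext fun ω => by rw [dropCount, Finset.sum_range_succ]; rfl]
    exact h2.add (measurable_const.indicator h5)

/-- Almost surely the learning rate drops infinitely often. Otherwise the step size is eventually
constant, and a block of data as in `ae_frequently_block`, with `z` interior to the support and
`z₁ = z + p`, `z₂ = z - p`, forces another increase of the test loss. The radius `ε` of the blocks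
does not depend on the path, and only countably many block lengths `K` occur. -/
lemma ae_tendsto_dropCount [MeasurableSpace Ω] {P : Measure Ω} [IsProbabilityMeasure P]
    (hd : 1 ≤ d) (hc : 0 < c)
    (hX_meas : ∀ n m, Measurable (X n m))
    (hX_indep : iIndepFun (fun p : ℤ × ℤ => X p.1 p.2) P)
    (hX_ident : ∀ n m n' m', IdentDistrib (X n m) (X n' m') P P)
    (hX_nondeg : IsNondegenerate (X 0 0) P) (hM : 1 ≤ M) (hM' : 1 ≤ M')
    (hΘ : ∀ n ω, Θ (n + 1) ω = Θ n ω +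
      r (dropCount (testLossIncrease c M' X Θ) n ω) • (batchMean M X n ω - Θ n ω))
    {α : ℝ} (hα : α < 2) (hr0 : ∀ k, 0 < r k) (hrα : ∀ k, r k ≤ α)
    (hbdd : ∀ᵐ ω ∂P, ∃ R : ℝ, ∀ n, ‖Θ n ω‖ ≤ R) :
    ∀ᵐ ω ∂P, Tendsto (fun n => dropCount (testLossIncrease c M' X Θ) n ω) atTop atTop := by
  have hκ : 0 < 2 - α := by linarith
  obtain ⟨z, hz⟩ := hX_nondeg
  obtain ⟨s, hs, hball⟩ := Metric.mem_nhds_iff.1 (mem_interior_iff_mem_nhds.1 hz)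
  obtain ⟨p, hps⟩ : ∃ p : EuclideanSpace ℝ (Fin d), ‖p‖ = s / 2 :=
    ⟨EuclideanSpace.single ⟨0, hd⟩ (s / 2), by simp [abs_of_pos hs]⟩
  have hp0 : p ≠ 0 := by rw [← norm_pos_iff, hps]; positivity
  have hp : 0 < ‖p‖ := norm_pos_iff.2 hp0
  obtain ⟨ε, hε⟩ : ∃ ε, ε = ‖p‖ / 8 / (1 + 2 / (2 - α)) := ⟨_, rfl⟩
  have hε0 : 0 < ε := by rw [hε]; positivity
  have hεp : (1 + 2 / (2 - α)) * ε ≤ ‖p‖ / 8 := by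
    rw [hε, mul_div_cancel₀]
    positivity
  have hsupp : ∀ y, ‖y - z‖ < s → P (X 0 0 ⁻¹' Metric.ball y ε) ≠ 0 := fun y hy =>
    measure_preimage_ball_ne_zero (hX_meas 0 0) (hball (mem_ball_iff_norm.2 hy)) hε0
  have hblock : ∀ᵐ ω ∂P, ∀ K, _ := ae_all_iff.2 fun K =>
    ae_frequently_block hX_meas hX_indep hX_ident (hsupp z (by simpa using hs))
      (hsupp (z + p) (by simp [hps, hs])) (hsupp (z - p) (by simp [hps, hs])) K M M'
  filter_upwards [hblock, hbdd] with ω hω hR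
  obtain ⟨R, hR⟩ := hR
  set J := fun n => dropCount (testLossIncrease c M' X Θ) n ω with hJ
  have hJm : Monotone J := dropCount_mono _ ω
  have hunb : ∀ n, ∃ k, J n < J k := by
    by_contra! hcon
    obtain ⟨n₀, hn₀⟩ := hcon
    have hconst : ∀ n ≥ n₀, J n = J n₀ := fun n hn => le_antisymm (hn₀ n) (hJm hn)
    set a := r (J n₀) with ha
    have ha1 : |1 - a| < 1 := by
      rw [abs_lt]; constructor <;> linarith [hr0 (J n₀), hrα (J n₀)]
    obtain ⟨K, hK⟩ : ∃ K : ℕ, |1 - a| ^ K * (R + ‖z‖) < ε := by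
      have : Tendsto (fun K : ℕ => |1 - a| ^ K * (R + ‖z‖)) atTop (𝓝 (0 * (R + ‖z‖))) :=
        (tendsto_pow_atTop_nhds_zero_of_lt_one (abs_nonneg _) ha1).mul_const _
      rw [zero_mul] at this
      exact (this.eventually_lt_const hε0).exists
    obtain ⟨j, ⟨hj0, hj1, hj2⟩, hj⟩ := ((hω K).and_eventually (eventually_ge_atTop n₀)).exists
    have hjn : n₀ ≤ j * (K + 1) := hj.trans (Nat.le_mul_of_pos_right j (by omega))
    have hlt : ∀ m ∈ Finset.Icc 1 M',
        ‖Θ (j * (K + 1) + K) ω - X ((j * (K + 1) + K + 1 : ℕ) : ℤ) (-(m : ℤ)) ω‖ <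
          ‖Θ (j * (K + 1) + K + 1) ω - X ((j * (K + 1) + K + 1 : ℕ) : ℤ) (-(m : ℤ)) ω‖ := by
      intro m hm
      refine norm_sub_lt_of_block (θ := fun n => Θ n ω) (x := fun n => batchMean M X n ω)
        (hr0 (J n₀)) (hrα _) hα hp0 hε0.le hεp (j * (K + 1)) K (fun i _ => ?_)
        (fun i hi => norm_average_sub_le hM (hj0 i hi)) (norm_average_sub_le hM hj1) ?_
        (hj2 m hm)
      · have := hconst (j * (K + 1) + i) (by omega)
        simp only [hJ] at this ⊢
        rw [hΘ, this]
      · refine le_trans ?_ hK.le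
        gcongr
        exact (norm_sub_le _ _).trans (by gcongr; exact hR _)
    have hmem : ω ∈ testLossIncrease c M' X Θ (j * (K + 1) + K) := by
      rw [testLossIncrease, Set.mem_ofPred_eq]
      refine Finset.sum_lt_sum_of_nonempty ⟨1, Finset.mem_Icc.2 ⟨le_rfl, hM'⟩⟩ fun m hm => ?_
      have := hlt m hm
      simp only [quadLoss]
      gcongr
    have h1 := dropCount_succ_of_mem hmem
    have h2 := hconst (j * (K + 1) + K) (by omega)
    have h3 := hconst (j * (K + 1) + K + 1) (by omega)
    simp only [hJ] at h2 h3
    omega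
  refine tendsto_atTop_atTop_of_monotone hJm fun b => ?_
  induction b with
  | zero => exact ⟨0, Nat.zero_le _⟩
  | succ b ih =>
    obtain ⟨n, hn⟩ := ih
    obtain ⟨k, hk⟩ := hunb n
    exact ⟨k, by omega⟩

end Sgd

/-! ### The past of the process and the moment condition -/

section Filtration
variable {Ω E : Type*} [mE : MeasurableSpace E]

/-- The σ-algebra generated by `Z` and the variables `X n m` with `n ≤ k`. It is written as the
supremum over the family on `Option (ℤ × ℤ)` in which `Z` has the index `none`. -/
@[reducible]
def pastSigma (X : ℤ → ℤ → Ω → E) (Z : Ω → E) (k : ℕ) : MeasurableSpace Ω :=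
  ⨆ o ∈ {o : Option (ℤ × ℤ) | ∀ p ∈ o, p.1 ≤ k},
    mE.comap (o.elim Z fun p => X p.1 p.2)

variable {X : ℤ → ℤ → Ω → E} {Z : Ω → E}

lemma pastSigma_mono : Monotone (pastSigma X Z) := fun _ _ hkl =>
  biSup_mono fun _ ho p hp => (ho p hp).trans (by exact_mod_cast hkl)

lemma measurable_pastSigma_initial (k : ℕ) : Measurable[pastSigma X Z k] Z :=
  Measurable.of_comap_le (le_iSup₂_of_le none (by simp) le_rfl)

lemma measurable_pastSigma_data {k : ℕ} {n : ℤ} (hn : n ≤ k) (m : ℤ) :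
    Measurable[pastSigma X Z k] (X n m) :=
  Measurable.of_comap_le (le_iSup₂_of_le (some (n, m)) (by simpa using hn) le_rfl)

variable [mΩ : MeasurableSpace Ω] {P : Measure Ω}

lemma pastSigma_le (hX : ∀ n m, Measurable (X n m)) (hZ : Measurable Z) (k : ℕ) :
    pastSigma X Z k ≤ mΩ := by
  refine iSup₂_le fun o _ => ?_
  cases o with
  | none => exact hZ.comap_le
  | some p => exact (hX p.1 p.2).comap_le

/-- The past up to `k` is independent of everything that is a function of the row `X (k + 1)`; the
latter is expressed by measurability with respect to every σ-algebra that makes the row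
measurable. -/
lemma indep_pastSigma_comap {E' : Type*} [MeasurableSpace E']
    (hX : ∀ n m, Measurable (X n m)) (hZ : Measurable Z)
    (hind : iIndepFun (fun p : ℤ × ℤ => X p.1 p.2) P)
    (hindZ : IndepFun (fun ω => fun p : ℤ × ℤ => X p.1 p.2 ω) Z P) (k : ℕ) {Y : Ω → E'}
    (hY : ∀ m₀ : MeasurableSpace Ω, (∀ m, Measurable[m₀] (X ((k + 1 : ℕ) : ℤ) m)) →
      Measurable[m₀] Y) :
    Indep (pastSigma X Z k) (MeasurableSpace.comap Y inferInstance) P := by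
  have h := hind.option_elim hindZ
  have h1 := indep_iSup_of_disjoint (S := {o : Option (ℤ × ℤ) | ∀ p ∈ o, p.1 ≤ k})
    (T := {o : Option (ℤ × ℤ) | ∃ p ∈ o, p.1 = ((k + 1 : ℕ) : ℤ)})
    (fun o => by
      cases o with
      | none => exact hZ.comap_le
      | some p => exact (hX p.1 p.2).comap_le) h
    (Set.disjoint_left.2 fun o ho ⟨p, hp, hp'⟩ => by
      have := ho p hp
      push_cast at hp'
      omega)
  refine indep_of_indep_of_le_right h1 (Measurable.comap_le (hY _ fun m => ?_))
  exact Measurable.of_comap_le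
    (le_iSup₂_of_le (some (((k + 1 : ℕ) : ℤ), m)) ⟨_, rfl, rfl⟩ le_rfl)

end Filtration

lemma memLp_two_and_ae_norm_le_of_lintegral_lt_top {Ω E : Type*} [MeasurableSpace Ω]
    {P : Measure Ω} [IsProbabilityMeasure P] [NormedAddCommGroup E] [MeasurableSpace E]
    [BorelSpace E] [SecondCountableTopology E] {X : ℤ → ℤ → Ω → E} {Z : Ω → E}
    (hX_meas : ∀ n m, Measurable (X n m)) (hZ : Measurable Z)
    (hX_indep : iIndepFun (fun p : ℤ × ℤ => X p.1 p.2) P)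
    (hX_ident : ∀ n m n' m', IdentDistrib (X n m) (X n' m') P P)
    (h_mom : ∫⁻ ω, (‖Z ω‖ₑ ^ 2 + ⨆ n : ℕ, ⨆ _ : 1 ≤ n, ‖X (n : ℤ) 0 ω‖ₑ) ∂P < ⊤) :
    MemLp Z 2 P ∧ ∃ B : ℝ, ∀ᵐ ω ∂P, ∀ n m, ‖X n m ω‖ ≤ B := by
  constructor
  · refine ⟨hZ.aestronglyMeasurable, ?_⟩
    rw [eLpNorm_lt_top_iff_lintegral_rpow_enorm_lt_top (by norm_num) (by norm_num)]
    refine lt_of_le_of_lt (lintegral_mono fun ω => ?_) h_mom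
    simp
  · have hm : Measurable fun ω => ‖Z ω‖ₑ ^ 2 + ⨆ n : ℕ, ⨆ _ : 1 ≤ n, ‖X (n : ℤ) 0 ω‖ₑ :=
      (hZ.enorm.pow_const 2).add
        (Measurable.iSup fun n => Measurable.iSup fun _ => (hX_meas n 0).enorm)
    have hfin := ae_lt_top hm h_mom.ne
    have hinj : Function.Injective fun n : ℕ => (((n + 1 : ℕ) : ℤ), (0 : ℤ)) := by
      intro a b hab
      simpa using hab
    obtain ⟨B, hB⟩ := (hX_indep.precomp hinj).exists_ae_norm_le (fun n => hX_meas _ _)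
      (fun n => hX_ident _ _ _ _) (hfin.mono fun ω hω => by
        refine lt_of_le_of_lt ?_ hω
        refine le_trans (iSup_le fun n => ?_) le_add_self
        exact le_iSup₂_of_le (n + 1) (by omega) le_rfl)
    refine ⟨B, ae_all_iff.2 fun n => ae_all_iff.2 fun m => ?_⟩
    exact (hX_ident _ _ n m).ae_snd (p := fun y => ‖y‖ ≤ B)
      (measurableSet_le measurable_norm measurable_const) hB

/-! ### Convergence of the adaptive method -/

/-- Sequences indexed by the positive integers (`γ`, `ν`) are functions on `ℕ` whose value at `0`
is never used. -/
theorem mainTheorem1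
    {Ω : Type*} [MeasurableSpace Ω] (P : Measure Ω) [IsProbabilityMeasure P]
    (d : ℕ) (hd : 1 ≤ d) (c : ℝ) (hc : 0 < c)
    -- the data: non-degenerate i.i.d. random variables
    (X : ℤ → ℤ → Ω → EuclideanSpace ℝ (Fin d))
    (hX_meas : ∀ n m, Measurable (X n m))
    (hX_indep : iIndepFun (fun p : ℤ × ℤ => X p.1 p.2) P)
    (hX_ident : ∀ n m n' m', IdentDistrib (X n m) (X n' m') P P)
    (hX_nondeg : ∀ n m, IsNondegenerate (X n m) P)
    -- the batch sizes for training and for testing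
    (M M' : ℕ) (hM : 1 ≤ M) (hM' : 1 ≤ M')
    -- the SGD process and the learning rates
    (Θ : ℕ → Ω → EuclideanSpace ℝ (Fin d)) (hΘ_meas : ∀ n, Measurable (Θ n))
    (γ : ℕ → Ω → ℝ) (hγ_meas : ∀ n, 1 ≤ n → Measurable (γ n))
    (hΘ : ∀ (n : ℕ) (ω : Ω),
      Θ (n + 1) ω = Θ n ω - (γ (n + 1) ω / M) •
        ∑ m ∈ Finset.Icc 1 M,
          gradient (fun θ => quadLoss c θ (X ((n + 1 : ℕ) : ℤ) (m : ℤ) ω)) (Θ n ω))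
    -- the possible values of the learning rates
    (ν : ℕ → ℝ) (hν_anti : StrictAntiOn ν (Set.Ici 1))
    (hν_lim : Tendsto ν atTop (𝓝 0))
    (hν_sum : Tendsto (fun n : ℕ => ∑ k ∈ Finset.Icc 1 n, ν k) atTop atTop)
    (hν_lt : ν 1 < c⁻¹)
    (hγ_one : ∀ ω, γ 1 ω = ν 1)
    -- no strict increase of the test loss: keep the learning rate
    (hγ_keep : ∀ (n : ℕ) (ω : Ω), 1 ≤ n →
      ∑ m ∈ Finset.Icc 1 M', quadLoss c (Θ n ω) (X (n : ℤ) (-(m : ℤ)) ω)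
        ≤ ∑ m ∈ Finset.Icc 1 M', quadLoss c (Θ (n - 1) ω) (X (n : ℤ) (-(m : ℤ)) ω) →
      γ (n + 1) ω = γ n ω)
    -- strict increase of the test loss: take the largest admissible value below the current one
    (hγ_drop : ∀ (n : ℕ) (ω : Ω), 1 ≤ n →
      ∑ m ∈ Finset.Icc 1 M', quadLoss c (Θ (n - 1) ω) (X (n : ℤ) (-(m : ℤ)) ω)
        < ∑ m ∈ Finset.Icc 1 M', quadLoss c (Θ n ω) (X (n : ℤ) (-(m : ℤ)) ω) →
      IsGreatest (Set.Ioo 0 (γ n ω) ∩ ν '' Set.Ici 1) (γ (n + 1) ω))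
    -- the initial value is independent of the data, and the moment condition
    (h_indep : IndepFun (fun ω => fun p : ℤ × ℤ => X p.1 p.2 ω) (Θ 0) P)
    (h_mom : ∫⁻ ω, (‖Θ 0 ω‖ₑ ^ 2 + ⨆ n : ℕ, ⨆ _ : 1 ≤ n, ‖X (n : ℤ) 0 ω‖ₑ) ∂P < ⊤) :
    Integrable (X 1 1) P ∧
    (∀ t : ℝ, 0 ≤ t →
      Integrable (fun ω => ‖Θ (crossingIndex γ t ω) ω - ∫ ω', X 1 1 ω' ∂P‖ ^ 2) P) ∧
    Tendsto (fun t : ℝ =>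
        ∫ ω, ‖Θ (crossingIndex γ t ω) ω - ∫ ω', X 1 1 ω' ∂P‖ ^ 2 ∂P)
      atTop (𝓝 0) := by
  set D := testLossIncrease c M' X Θ
  have hM0 : (0 : ℝ) < M := by exact_mod_cast hM
  have hνpos : ∀ k, 0 < ν (k + 1) := fun k =>
    pos_of_strictAntiOn_of_tendsto_zero hν_anti hν_lim (by omega)
  have hνle : ∀ j k, j ≤ k → ν (k + 1) ≤ ν (j + 1) := fun j k hjk =>
    hν_anti.antitoneOn (by simp) (by simp) (by omega)
  have hγ : ∀ n ω, γ (n + 1) ω = ν (dropCount D n ω + 1) :=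
    eq_rate_dropCount hν_anti hν_lim hγ_one
      (fun n ω h => hγ_keep (n + 1) ω (by omega) (not_lt.1 h))
      (fun n ω h => hγ_drop (n + 1) ω (by omega) h)
  -- the relaxation parameter belonging to the `k`-th admissible learning rate
  set r : ℕ → ℝ := fun k => 2 * c * ν (k + 1) with hr
  have hr0 : ∀ k, 0 < r k := fun k => by have := hνpos k; positivity
  have hrα : ∀ k, r k ≤ r 0 := fun k => by
    simp only [hr]; gcongr; exact hνle 0 k k.zero_le
  have hα : r 0 < 2 := by
    have := mul_lt_mul_of_pos_left hν_lt hc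
    rw [mul_inv_cancel₀ hc.ne'] at this
    simp only [hr, zero_add]
    linarith
  have hrec : ∀ n ω, Θ (n + 1) ω = Θ n ω +
      r (dropCount D n ω) • (batchMean M X n ω - Θ n ω) := by
    intro n ω
    have h1 : r (dropCount D n ω) = 2 * c * γ (n + 1) ω := by rw [hγ]
    rw [hΘ, h1]
    simp only [gradient_quadLoss]
    rw [batchMean, ← Finset.smul_sum, Finset.sum_sub_distrib]
    simp only [Finset.sum_const, Nat.card_Icc, Nat.add_sub_cancel, ← Nat.cast_smul_eq_nsmul ℝ]
    match_scalars <;> (field_simp; try ring)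
  obtain ⟨hΘ0, B, hB⟩ := memLp_two_and_ae_norm_le_of_lintegral_lt_top hX_meas (hΘ_meas 0)
    hX_indep hX_ident h_mom
  have hxB : ∀ᵐ ω ∂P, ∀ n, ‖batchMean M X n ω‖ ≤ B := hB.mono fun ω h n => by
    simpa [batchMean] using norm_average_sub_le hM
      (x := fun m : ℕ => X ((n + 1 : ℕ) : ℤ) (m : ℤ) ω) (z := 0) (by simpa using fun m _ _ => h _ _)
  have hXint : ∀ n m, Integrable (X n m) P := fun n m =>
    Integrable.of_bound (hX_meas n m).aestronglyMeasurable B (hB.mono fun ω h => h n m)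
  have hmean : ∀ n, ∫ ω, batchMean M X n ω ∂P = ∫ ω, X 1 1 ω ∂P := by
    intro n
    simp only [batchMean]
    rw [integral_smul, integral_finsetSum _ fun m _ => hXint _ _]
    simp [fun m : ℤ => (hX_ident ((n : ℤ) + 1) m 1 1).integral_eq, ← Nat.cast_smul_eq_nsmul ℝ,
      smul_smul, hM0.ne']
  have hadapt := measurable_iterate_and_dropCount (pastSigma_mono (X := X) (Z := Θ 0))
    (measurable_pastSigma_initial 0) (fun n m => measurable_pastSigma_data le_rfl m) hrec
  have hdrop : ∀ᵐ ω ∂P, Tendsto (fun n => dropCount D n ω) atTop atTop := by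
    refine ae_tendsto_dropCount hd hc hX_meas hX_indep hX_ident (hX_nondeg 0 0) hM hM' hrec hα
      hr0 hrα (hxB.mono fun ω h => ⟨max ‖Θ 0 ω‖ (2 / (2 - r 0) * B), ?_⟩)
    exact norm_relax_le_max (θ := fun n => Θ n ω) (x := fun n => batchMean M X n ω) hα
      (fun n => hrec n ω) (fun n => (hr0 _).le) (fun n => hrα _) h
  have hrlim : Tendsto r atTop (𝓝 0) := by
    simpa using (hν_lim.comp (tendsto_add_atTop_nat 1)).const_mul (2 * c)
  have hrsum : Tendsto (fun n => ∑ k ∈ Finset.range n, r k) atTop atTop := by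
    simp only [hr, ← Finset.mul_sum]
    simp only [sum_Icc_one_eq_sum_range] at hν_sum
    exact hν_sum.const_mul_atTop (by positivity)
  obtain ⟨h1, h2⟩ := tendsto_integral_norm_sq_firstPassage (F := pastSigma X (Θ 0)) (θ := Θ)
    (x := batchMean M X) (a := fun n ω => r (dropCount D n ω)) (b := r)
    (pastSigma_le hX_meas (hΘ_meas 0)) (fun n => (hadapt n).1)
    (fun n k hk => (measurable_from_nat (f := r)).comp
      ((hadapt k).2.mono (pastSigma_mono hk) le_rfl))
    (fun n => measurable_batchMean fun m => hX_meas _ m)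
    (fun n => indep_pastSigma_comap hX_meas (hΘ_meas 0) hX_indep h_indep n
      fun m₀ h => measurable_batchMean h)
    _ hmean hxB hα (fun n ω => (hr0 _).le) (fun n ω => hrα _) hrec hΘ0
    (fun n ω => by
      have := hνle _ _ (dropCount_le D n ω)
      simp only [hr]; gcongr)
    hrsum (hdrop.mono fun ω h => hrlim.comp h)
  -- the step sizes are `2 * c` times the learning rates, so time is rescaled by this factor
  have hcross : ∀ t ω, crossingIndex γ t ω =
      firstPassage (fun n => r (dropCount D n ω)) (2 * c * t) := by
    intro t ω
    rw [crossingIndex, firstPassage]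
    congr 1
    ext n
    simp only [Set.mem_ofPred_eq, hr, sum_Icc_one_eq_sum_range, hγ, ← Finset.mul_sum]
    exact (mul_le_mul_iff_right₀ (by positivity)).symm
  simp only [hcross]
  exact ⟨hXint 1 1, fun t _ => h1 _, h2.comp (tendsto_id.const_mul_atTop (by positivity))⟩
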